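/- Let $(\varphi_e)_{e\in\mathbb N}$ be a standard acceptable enumeration of the partial computable functions. A number $e$ is an \emph{index} of a group $G$ whose universe is a set of natural numbers if $\varphi_e$ computes (the characteristic function of) the atomic diagram $\{(a,b,c) : a,b,c\in G,\ a\cdot b=c\}$ of $G$. A group is \emph{computable} if it is isomorphic to a group on a set of natural numbers that has an index. Let $P$ be an isomorphism-invariant property of groups which is \emph{Markov for computable groups}, witnessed by $G_+$ and $G_-$: that is, $G_+$ and $G_-$ are computable groups, $G_+$ has $P$, and no group into which $G_-$ embeds has $P$. Then detecting $P$ is $\Pi^0_1$-hard in the class of computable groups: for every $\Pi^0_1$ set $S\subseteq\mathbb N$ there is a computable function $f:\mathbb N\to\mathbb N$ such that, for every $e$, $f(e)$ is an index of a group, and $e\in S$ if and only if the group with index $f(e)$ has $P$. If $G_+$ is infinite, then $f$ can be chosen so that in addition every group with index $f(e)$ has universe $\mathbb N$; that is, detecting $P$ is also $\Pi^0_1$-hard in the class of computable groups with universe $\mathbb N$. Moreover, there is a computable function $f$ such that, for every $e$, $f(e)$ is an index of a group $G_e$ (with universe $\mathbb N$ if $G_+$ is infinite), where $G_e\cong G_+$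 if $\varphi_e(e)$ diverges and $G_e\cong G_+\times G_-$ if $\varphi_e(e)$ converges. -/

import Mathlib

/-- The `e`-th partial computable function `φ_e` in the standard (acceptable) Gödel numbering. -/
def phi (e : ℕ) : ℕ →. ℕ := (Denumerable.ofNat Nat.Partrec.Code e).eval

/-- `φ_e` computes the set `T`: it is total on codes and is the characteristic function of `T`. -/
def ComputesSet {α : Type} [Primcodable α] (e : ℕ) (T : Set α) : Prop :=
  ∀ t : α, (t ∈ T → phi e (Encodable.encode t) = Part.some 1) ∧
    (t ∉ T → phi e (Encodable.encode t) = Part.some 0)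

/-- A group whose universe is a set of natural numbers. -/
structure NatGroup where
  carrier : Set ℕ
  group : Group carrier

instance (G : NatGroup) : Group G.carrier := G.group

/-- The atomic diagram of `G`: all triples `(a, b, c)` with `a`, `b`, `c` in the universe and
`a * b = c`. The universe is the set of first coordinates; it is decidable from the diagram, as
`x` is in the universe iff `(x, i, x)` is in the diagram, where `(i, i, i)` is the unique triple of
that shape. Equality of elements is equality of natural numbers. -/
def NatGroup.atomicDiagram (G : NatGroup) : Set (ℕ × ℕ × ℕ) :=
  {t | ∃ a b : G.carrier, t = ((a : ℕ), (b : ℕ), ((a * b : G.carrier) : ℕ))}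

/-- `e` is an index of `G`: `φ_e` computes the atomic diagram of `G`. -/
def IsIndexOf (e : ℕ) (G : NatGroup) : Prop := ComputesSet e G.atomicDiagram

/-- An index is an index of at most one group. -/
theorem IsIndexOf.unique {e : ℕ} {G H : NatGroup} (hG : IsIndexOf e G) (hH : IsIndexOf e H) :
    G = H := by
  have hd : G.atomicDiagram = H.atomicDiagram := by
    ext t
    by_cases h1 : t ∈ G.atomicDiagram <;> by_cases h2 : t ∈ H.atomicDiagram
    · simp [h1, h2]
    · have := ((hG t).1 h1).symm.trans ((hH t).2 h2)
      simp at this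
    · have := ((hG t).2 h1).symm.trans ((hH t).1 h2)
      simp at this
    · simp [h1, h2]
  have key : ∀ K : NatGroup, K.carrier = {x | ∃ y z, (x, y, z) ∈ K.atomicDiagram} := by
    intro K
    ext x
    constructor
    · intro hx
      exact ⟨x, _, ⟨x, hx⟩, ⟨x, hx⟩, rfl⟩
    · rintro ⟨y, z, a, b, h⟩
      have : x = a := congrArg Prod.fst h
      exact this ▸ a.2
  have hc : G.carrier = H.carrier := by rw [key G, key H, hd]
  obtain ⟨D, g⟩ := G
  obtain ⟨D', g'⟩ := H
  obtain rfl : D = D' := hc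
  congr 1
  apply Group.ext
  ext a b
  have hm : ((a : ℕ), (b : ℕ), ((g.mul a b : D) : ℕ)) ∈ NatGroup.atomicDiagram ⟨D, g'⟩ := by
    rw [← hd]
    exact ⟨a, b, rfl⟩
  obtain ⟨a', b', h⟩ := hm
  obtain rfl : a = a' := Subtype.ext (congrArg Prod.fst h)
  obtain rfl : b = b' := Subtype.ext (congrArg (fun t => t.2.1) h)
  exact congrArg (fun t => t.2.2) h

/-- A property (equivalently, a class) of groups, as a predicate. -/
abbrev GroupProperty := ∀ (G : Type) [Group G], Prop

/-- Properties of groups are invariant under isomorphism. -/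
def IsoInvariant (P : GroupProperty) : Prop :=
  ∀ (G H : Type) [Group G] [Group H], Nonempty (G ≃* H) → P G → P H

/-- The class of computable groups: the groups with a copy, on a set of natural numbers, whose
atomic diagram is computed by some `φ_e`. -/
def IsComputableGroup : GroupProperty := fun G _ =>
  ∃ (K : NatGroup) (e : ℕ), IsIndexOf e K ∧ Nonempty (G ≃* K.carrier)

/-- `Gp` and `Gm` witness that the property `P` is Markov for the class `C` of groups. -/
def IsMarkovWitness (C P : GroupProperty) (Gp Gm : Type) [Group Gp] [Group Gm] : Prop :=
  C Gp ∧ P Gp ∧ C Gm ∧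
    ∀ (H : Type) [Group H], (∃ i : Gm →* H, Function.Injective i) → ¬ P H

/-- The set of indices of computable groups. -/
def computableGroupIndices : Set ℕ := {e | ∃ G : NatGroup, IsIndexOf e G}

/-- The set of indices of computable groups with universe `ℕ`. -/
def omegaGroupIndices : Set ℕ := {e | ∃ G : NatGroup, IsIndexOf e G ∧ G.carrier = Set.univ}

/-- The set of indices in `A` of groups that have property `P`. -/
def indicesWith (A : Set ℕ) (P : GroupProperty) : Set ℕ :=
  {e | e ∈ A ∧ ∃ G : NatGroup, IsIndexOf e G ∧ P G.carrier}

/-- The class of `Π⁰₁` sets: those of the form `{e | ∀ n, R e n}` with `R` computable. -/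
def PiZeroOne : Set (Set ℕ) :=
  {S | ∃ R : ℕ → ℕ → Prop, ComputablePred (fun p : ℕ × ℕ => R p.1 p.2) ∧
    ∀ e, e ∈ S ↔ ∀ n, R e n}

/-- Detecting the property `P` is `Γ`-hard in the set `A` of indices of groups. -/
def DetectionHard (Γ : Set (Set ℕ)) (A : Set ℕ) (P : GroupProperty) : Prop :=
  ∀ S ∈ Γ, ∃ f : ℕ → ℕ, Computable f ∧ (∀ e, f e ∈ A) ∧ ∀ e, e ∈ S ↔ f e ∈ indicesWith A P

/-!
Fix computable copies of `Gp` and `Gm` on sets of natural numbers. Given a `Σ⁰₁` event, let `H` be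
the trivial subgroup of `Gm` if the event never occurs and all of `Gm` if it does; the group to build is
`Gp × H`. It has to be decidable in advance which numbers are elements, although the event may occur
arbitrarily late. For this, `(a, b)` with `b ≠ 1` is coded by the codes of `a` and `b` together with
the stage at which the event first occurs, while `(a, 1)` gets the marker `0`: whether a given stage
is the first one at which the event occurs is decidable, so the atomic diagram of `Gp × H` is
decidable uniformly in the event (`computablePred_markedDiagram`, `diagram_markedCode`). The
`s`-`m`-`n` theorem turns this uniform decision procedure into a computable function producing
indices (`exists_computable_computesSet`).

If `Gp` is infinite, so is the set of codes, and renaming its `n`-th element to `n` gives a copy with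
universe `ℕ`; enumerating an infinite decidable set in increasing order is computable
(`ComputablePred.nth`).

If the event does not occur, the group is isomorphic to `Gp` and has the property. If it occurs, the
group is isomorphic to `Gp × Gm`, into which `Gm` embeds, and does not have it.
-/

/-! ### Computable predicates -/

namespace ComputablePred

variable {α β : Type*} [Primcodable α] [Primcodable β]

theorem comp {p : β → Prop} (hp : ComputablePred p) {f : α → β} (hf : Computable f) :
    ComputablePred fun a => p (f a) := by
  obtain ⟨_, h⟩ := hp
  exact ⟨inferInstance, h.comp hf⟩

theorem and {p q : α → Prop} (hp : ComputablePred p) (hq : ComputablePred q) :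
    ComputablePred fun a => p a ∧ q a := by
  obtain ⟨_, hp⟩ := hp
  obtain ⟨_, hq⟩ := hq
  exact ⟨inferInstance, (Primrec.and.to_comp.comp hp hq).of_eq fun _ => by simp⟩

theorem or {p q : α → Prop} (hp : ComputablePred p) (hq : ComputablePred q) :
    ComputablePred fun a => p a ∨ q a := by
  obtain ⟨_, hp⟩ := hp
  obtain ⟨_, hq⟩ := hq
  exact ⟨inferInstance, (Primrec.or.to_comp.comp hp hq).of_eq fun _ => by simp⟩

theorem nat_eq {f g : α → ℕ} (hf : Computable f) (hg : Computable g) :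
    ComputablePred fun a => f a = g a :=
  ⟨inferInstance, Primrec.eq.decide.to_comp.comp hf hg⟩

theorem count {U : α → ℕ → Prop} [∀ a, DecidablePred (U a)]
    (hU : ComputablePred fun q : α × ℕ => U q.1 q.2) :
    Computable fun q : α × ℕ => Nat.count (U q.1) q.2 := by
  have hstep : Computable fun r : (α × ℕ) × (ℕ × ℕ) =>
      bif decide (U r.1.1 r.2.1) then r.2.2 + 1 else r.2.2 :=
    Computable.cond
      (hU.decide.comp ((Computable.fst.comp Computable.fst).pair
        (Computable.fst.comp Computable.snd)))
      (Computable.succ.comp (Computable.snd.comp Computable.snd))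
      (Computable.snd.comp Computable.snd)
  refine (Computable.nat_rec Computable.snd (Computable.const 0) hstep.to₂).of_eq ?_
  rintro ⟨a, n⟩
  induction n with
  | zero => simp
  | succ n ih =>
    simp only at ih ⊢
    rw [ih, Nat.count_succ]
    by_cases h : U a n <;> simp [h]

theorem nth {U : α → ℕ → Prop} (hU : ComputablePred fun q : α × ℕ => U q.1 q.2)
    (hinf : ∀ a, {n | U a n}.Infinite) :
    Computable fun q : α × ℕ => Nat.nth (U q.1) q.2 := by
  classical
  -- The `n`-th element of an infinite set is its only element with `n` predecessors in the set,
  -- so an unbounded search finds it.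
  let V : α × ℕ → ℕ → Prop := fun q x => U q.1 x ∧ Nat.count (U q.1) x = q.2
  have hV : ComputablePred fun r : (α × ℕ) × ℕ => V r.1 r.2 := by
    have hg : Computable fun r : (α × ℕ) × ℕ => (r.1.1, r.2) :=
      (Computable.fst.comp Computable.fst).pair Computable.snd
    exact (hU.comp hg).and
      (nat_eq (hU.count.comp hg) (Computable.snd.comp Computable.fst))
  have hex : ∀ q, ∃ x, V q x := fun q =>
    ⟨Nat.nth (U q.1) q.2, Nat.nth_mem_of_infinite (hinf q.1) _,
      Nat.count_nth_of_infinite (hinf q.1) _⟩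
  refine (Computable.find hV hex).of_eq fun q => ?_
  obtain ⟨h1, h2⟩ := Nat.find_spec (hex q)
  rw [← Nat.nth_count h1, h2]

/-- Being the least counterexample to a computable relation is decidable, by bounded search. -/
theorem isLeast_not {R : α → ℕ → Prop} (hR : ComputablePred fun q : α × ℕ => R q.1 q.2) :
    ComputablePred fun q : α × ℕ => IsLeast {n | ¬ R q.1 n} q.2 := by
  classical
  have hc := ComputablePred.count (U := fun a n => ¬ R a n) hR.not
  refine (hR.not.and (nat_eq hc (Computable.const 0))).of_eq fun q => and_congr Iff.rfl
    (Nat.count_iff_forall_not.trans ?_)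
  exact ⟨fun h n hn => not_lt.1 fun hlt => h n hlt hn, fun h m hm hn => (h hn).not_gt hm⟩

end ComputablePred

/-! ### Indices of sets -/

/-- A uniformly decidable sequence of sets has a computable sequence of indices. -/
theorem exists_computable_computesSet {α : Type} [Primcodable α] {p : ℕ → α → Prop}
    (hp : ComputablePred fun q : ℕ × α => p q.1 q.2) :
    ∃ f : ℕ → ℕ, Computable f ∧ ∀ e, ComputesSet (f e) {t | p e t} := by
  classical
  replace hp := hp.decide
  have hχ : Computable fun q : ℕ × α => bif decide (p q.1 q.2) then 1 else 0 :=
    Computable.cond hp (Computable.const 1) (Computable.const 0)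
  obtain ⟨c, hc⟩ := Nat.Partrec.Code.exists_code.1 hχ
  refine ⟨fun e => Encodable.encode (c.curry e),
    Computable.encode.comp (Nat.Partrec.Code.primrec₂_curry.to_comp.comp
      (Computable.const c) Computable.id), fun e t => ?_⟩
  have key : phi (Encodable.encode (c.curry e)) (Encodable.encode t) =
      Part.some (bif decide (p e t) then 1 else 0) := by
    rw [phi, Denumerable.ofNat_encode, Nat.Partrec.Code.eval_curry, hc]
    have : Nat.pair e (Encodable.encode t) = Encodable.encode (e, t) := rfl
    beta_reduce
    rw [this, Encodable.encodek, Part.coe_some, Part.bind_some]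
    exact Part.map_some _ _
  constructor <;> intro h <;> rw [key] <;> simp_all

theorem ComputesSet.computablePred {α : Type} [Primcodable α] {e : ℕ} {T : Set α}
    (h : ComputesSet e T) : ComputablePred fun t => t ∈ T := by
  classical
  have hphi : Partrec (phi e) :=
    Partrec.nat_iff.2 (Nat.Partrec.Code.exists_code.2 ⟨Denumerable.ofNat Nat.Partrec.Code e, rfl⟩)
  have hχ : Computable fun t : α => if t ∈ T then 1 else 0 := by
    refine (hphi.comp Computable.encode).of_eq_tot fun t => ?_
    by_cases ht : t ∈ T
    · simp [(h t).1 ht, ht]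
    · simp [(h t).2 ht, ht]
  refine (ComputablePred.nat_eq hχ (Computable.const 1)).of_eq fun t => ?_
  by_cases ht : t ∈ T <;> simp [ht]

/-! ### Ranks in an increasing enumeration -/

section Rank

variable {X : Type} {ν : X → ℕ}

open Classical in
/-- The position of `ν x` in the increasing enumeration of the range of `ν`. -/
noncomputable def rankCode (ν : X → ℕ) (x : X) : ℕ := Nat.count (· ∈ Set.range ν) (ν x)

theorem nth_rankCode (ν : X → ℕ) (x : X) : Nat.nth (· ∈ Set.range ν) (rankCode ν x) = ν x := by
  classical
  exact Nat.nth_count (p := (· ∈ Set.range ν)) ⟨x, rfl⟩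

theorem rankCode_injective (hν : Function.Injective ν) : Function.Injective (rankCode ν) :=
  fun x y h => hν <| by rw [← nth_rankCode ν x, h, nth_rankCode]

theorem rankCode_surjective [Infinite X] (hν : Function.Injective ν) :
    Function.Surjective (rankCode ν) := fun n => by
  classical
  have hinf := Set.infinite_range_of_injective hν
  obtain ⟨x, hx⟩ := Nat.nth_mem_of_infinite (p := (· ∈ Set.range ν)) hinf n
  refine ⟨x, ?_⟩
  rw [rankCode, hx]
  exact Nat.count_nth_of_infinite (p := (· ∈ Set.range ν)) hinf n

end Rank

/-! ### Copies of groups on sets of natural numbers -/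

section Copies

variable {G : Type} [Group G]

/-- The atomic diagram of the copy of `G` obtained by naming each `x : G` by the number `ν x`. -/
def diagram (ν : G → ℕ) : Set (ℕ × ℕ × ℕ) :=
  Set.range fun q : G × G => (ν q.1, ν q.2, ν (q.1 * q.2))

/-- The copy of `G` on the range of an injection `ν : G → ℕ`. -/
noncomputable def NatGroup.ofInjective (ν : G → ℕ) (hν : Function.Injective ν) : NatGroup where
  carrier := Set.range ν
  group := (Equiv.ofInjective ν hν).symm.group

/-- The isomorphism sending the name `ν x` back to `x`. -/
noncomputable def NatGroup.ofInjectiveEquiv (ν : G → ℕ) (hν : Function.Injective ν) :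
    (NatGroup.ofInjective ν hν).carrier ≃* G :=
  letI := (Equiv.ofInjective ν hν).symm.group
  (Equiv.ofInjective ν hν).symm.mulEquiv

theorem NatGroup.atomicDiagram_eq_diagram (K : NatGroup) (i : G ≃* K.carrier) :
    K.atomicDiagram = diagram fun x => (i x : ℕ) := by
  ext t
  constructor
  · rintro ⟨a, b, rfl⟩
    exact ⟨(i.symm a, i.symm b), by simp⟩
  · rintro ⟨⟨x, y⟩, rfl⟩
    exact ⟨i x, i y, by simp⟩

theorem NatGroup.atomicDiagram_ofInjective (ν : G → ℕ) (hν : Function.Injective ν) :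
    (NatGroup.ofInjective ν hν).atomicDiagram = diagram ν :=
  NatGroup.atomicDiagram_eq_diagram _ (NatGroup.ofInjectiveEquiv ν hν).symm

theorem IsComputableGroup.exists_injective (h : IsComputableGroup G) :
    ∃ ν : G → ℕ, Function.Injective ν ∧ ComputablePred fun t => t ∈ diagram ν := by
  obtain ⟨K, e, he, ⟨i⟩⟩ := h
  refine ⟨fun x => i x, Subtype.val_injective.comp i.injective, ?_⟩
  rw [← K.atomicDiagram_eq_diagram i]
  exact he.computablePred

theorem mem_diagram_apply {ν : G → ℕ} (hν : Function.Injective ν) {x y z : G} :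
    (ν x, ν y, ν z) ∈ diagram ν ↔ x * y = z := by
  constructor
  · rintro ⟨⟨x', y'⟩, h⟩
    simp only [Prod.mk.injEq] at h
    rw [← hν h.1, ← hν h.2.1, hν h.2.2]
  · rintro rfl
    exact ⟨(x, y), rfl⟩

theorem exists_of_mem_diagram {ν : G → ℕ} {x y z : ℕ} (h : (x, y, z) ∈ diagram ν) :
    ∃ a b c, ν a = x ∧ ν b = y ∧ ν c = z := by
  obtain ⟨⟨a, b⟩, h⟩ := h
  simp only [Prod.mk.injEq] at h
  exact ⟨a, b, a * b, h⟩

/-- A number names an element iff it solves `x * 1 = x`, which the diagram decides. -/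
theorem mem_range_iff_mem_diagram {ν : G → ℕ} (hν : Function.Injective ν) {n : ℕ} :
    n ∈ Set.range ν ↔ (n, ν 1, n) ∈ diagram ν := by
  constructor
  · rintro ⟨x, rfl⟩
    exact (mem_diagram_apply hν).2 (mul_one x)
  · intro h
    obtain ⟨a, -, -, h, -⟩ := exists_of_mem_diagram h
    exact ⟨a, h⟩

theorem mem_diagram_rankCode [Infinite G] {ν : G → ℕ} (hν : Function.Injective ν) {x y z : ℕ} :
    (x, y, z) ∈ diagram (rankCode ν) ↔
      (Nat.nth (· ∈ Set.range ν) x, Nat.nth (· ∈ Set.range ν) y, Nat.nth (· ∈ Set.range ν) z) ∈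
        diagram ν := by
  obtain ⟨a, rfl⟩ := rankCode_surjective hν x
  obtain ⟨b, rfl⟩ := rankCode_surjective hν y
  obtain ⟨c, rfl⟩ := rankCode_surjective hν z
  rw [nth_rankCode, nth_rankCode, nth_rankCode, mem_diagram_apply hν,
    mem_diagram_apply (rankCode_injective hν)]

end Copies

/-! ### Products with a factor switched on by an event -/

section Marked

variable {A B : Type} [Group B]

/-- The subgroup of `B` that is trivial if the event `E` does not occur and all of `B` if it does. -/
def eventSubgroup (B : Type) [Group B] (E : Prop) : Subgroup B where
  carrier := {b | b = 1 ∨ E}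
  one_mem' := Or.inl rfl
  mul_mem' := by
    rintro a b (rfl | h) (rfl | h')
    exacts [Or.inl (one_mul 1), Or.inr h', Or.inr h, Or.inr h]
  inv_mem' := by
    rintro a (rfl | h)
    exacts [Or.inl inv_one, Or.inr h]

theorem mem_eventSubgroup {E : Prop} {b : B} : b ∈ eventSubgroup B E ↔ b = 1 ∨ E := Iff.rfl

theorem nonempty_prod_eventSubgroup_of_not [Group A] {E : Prop} (h : ¬ E) :
    Nonempty (A × eventSubgroup B E ≃* A) := by
  have : eventSubgroup B E = ⊥ := by
    ext b
    simp [mem_eventSubgroup, h]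
  rw [this]
  exact ⟨MulEquiv.prodUnique⟩

theorem nonempty_prod_eventSubgroup_of [Group A] {E : Prop} (h : E) :
    Nonempty (A × eventSubgroup B E ≃* A × B) := by
  have : eventSubgroup B E = ⊤ := by
    ext b
    simp [mem_eventSubgroup, h]
  rw [this]
  exact ⟨(MulEquiv.refl A).prodCongr Subgroup.topEquiv⟩

open Classical in
/-- The code of `(a, b)`: the codes of `a` and `b`, and a marker, which is the least element of `W`
unless `b = 1`. -/
noncomputable def markedCode (α : A → ℕ) (β : B → ℕ) (W : Set ℕ)
    (x : A × eventSubgroup B W.Nonempty) : ℕ :=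
  Nat.pair (α x.1) (Nat.pair (β x.2) (if (x.2 : B) = 1 then 0 else sInf W))

theorem markedCode_injective {α : A → ℕ} {β : B → ℕ} (hα : Function.Injective α)
    (hβ : Function.Injective β) (W : Set ℕ) : Function.Injective (markedCode α β W) := by
  rintro ⟨a, b⟩ ⟨a', b'⟩ h
  simp only [markedCode, Nat.pair_eq_pair] at h
  exact Prod.ext (hα h.1) (Subtype.ext (hβ h.2.1))

/-- Validity of a coded pair `m` of an element of the second factor and a marker, `i` being the code
of the identity. -/
def ValidMarker (i : ℕ) (W : Set ℕ) (m : ℕ) : Prop :=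
  m.unpair.1 = i ∧ m.unpair.2 = 0 ∨ m.unpair.1 ≠ i ∧ IsLeast W m.unpair.2

open Classical in
theorem validMarker_pair {β : B → ℕ} (hβ : Function.Injective β) {W : Set ℕ} {b : B} {s : ℕ} :
    ValidMarker (β 1) W (Nat.pair (β b) s) ↔
      b ∈ eventSubgroup B W.Nonempty ∧ s = if b = 1 then 0 else sInf W := by
  rw [ValidMarker, Nat.unpair_pair, mem_eventSubgroup, ne_eq, hβ.eq_iff]
  by_cases hb : b = 1
  · simp [hb]
  · simp only [hb, false_and, not_false_eq_true, true_and, false_or, if_false]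
    constructor
    · intro h
      exact ⟨h.nonempty, h.csInf_eq.symm⟩
    · rintro ⟨h, rfl⟩
      exact ⟨Nat.sInf_mem h, fun n hn => Nat.sInf_le hn⟩

/-- The explicit description of `diagram (markedCode α β W)`; see `diagram_markedCode`. -/
def markedDiagram [Group A] (α : A → ℕ) (β : B → ℕ) (W : Set ℕ) : Set (ℕ × ℕ × ℕ) :=
  {t | (t.1.unpair.1, t.2.1.unpair.1, t.2.2.unpair.1) ∈ diagram α ∧
    (t.1.unpair.2.unpair.1, t.2.1.unpair.2.unpair.1, t.2.2.unpair.2.unpair.1) ∈ diagram β ∧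
    ValidMarker (β 1) W t.1.unpair.2 ∧ ValidMarker (β 1) W t.2.1.unpair.2 ∧
    ValidMarker (β 1) W t.2.2.unpair.2}

theorem exists_markedCode_eq {α : A → ℕ} {β : B → ℕ} (hβ : Function.Injective β) {W : Set ℕ}
    {n : ℕ} {a : A} {b : B} (ha : α a = n.unpair.1) (hb : β b = n.unpair.2.unpair.1)
    (hn : ValidMarker (β 1) W n.unpair.2) : ∃ x, markedCode α β W x = n := by
  classical
  rw [← Nat.pair_unpair n.unpair.2, ← hb, validMarker_pair hβ] at hn
  refine ⟨(a, ⟨b, hn.1⟩), ?_⟩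
  simp only [markedCode, ← hn.2, ha, hb, Nat.pair_unpair]

theorem diagram_markedCode [Group A] {α : A → ℕ} {β : B → ℕ} (hα : Function.Injective α)
    (hβ : Function.Injective β) (W : Set ℕ) :
    diagram (markedCode α β W) = markedDiagram α β W := by
  classical
  have valid : ∀ x, ValidMarker (β 1) W (markedCode α β W x).unpair.2 := by
    rintro ⟨a, b⟩
    rw [markedCode, Nat.unpair_pair]
    exact (validMarker_pair hβ).2 ⟨b.2, rfl⟩
  ext ⟨x, y, z⟩
  constructor
  · rintro ⟨⟨p, q⟩, h⟩
    rw [← h]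
    refine ⟨?_, ?_, valid _, valid _, valid _⟩ <;> simp only [markedCode, Nat.unpair_pair]
    · exact (mem_diagram_apply hα).2 rfl
    · exact (mem_diagram_apply hβ).2 rfl
  · rintro ⟨h₁, h₂, hx, hy, hz⟩
    simp only at h₁ h₂ hx hy hz
    obtain ⟨a, a', a'', ha, ha', ha''⟩ := exists_of_mem_diagram h₁
    obtain ⟨b, b', b'', hb, hb', hb''⟩ := exists_of_mem_diagram h₂
    obtain ⟨p, rfl⟩ := exists_markedCode_eq hβ ha hb hx
    obtain ⟨q, rfl⟩ := exists_markedCode_eq hβ ha' hb' hy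
    obtain ⟨r, rfl⟩ := exists_markedCode_eq hβ ha'' hb'' hz
    rw [mem_diagram_apply (markedCode_injective hα hβ W)]
    simp only [markedCode, Nat.unpair_pair] at h₁ h₂
    exact Prod.ext ((mem_diagram_apply hα).1 h₁) (Subtype.ext ((mem_diagram_apply hβ).1 h₂))

theorem computablePred_validMarker (i : ℕ) {W : ℕ → Set ℕ}
    (hW : ComputablePred fun q : ℕ × ℕ => IsLeast (W q.1) q.2) :
    ComputablePred fun q : ℕ × ℕ => ValidMarker i (W q.1) q.2 := by
  have h1 : Computable fun q : ℕ × ℕ => q.2.unpair.1 :=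
    Computable.fst.comp (Computable.unpair.comp Computable.snd)
  have h2 : Computable fun q : ℕ × ℕ => q.2.unpair.2 :=
    Computable.snd.comp (Computable.unpair.comp Computable.snd)
  have hi := ComputablePred.nat_eq h1 (Computable.const i)
  exact (hi.and (ComputablePred.nat_eq h2 (Computable.const 0))).or
    (hi.not.and (hW.comp (Computable.fst.pair h2)))

theorem computablePred_markedDiagram [Group A] {α : A → ℕ} {β : B → ℕ}
    (hα : ComputablePred fun t => t ∈ diagram α) (hβ : ComputablePred fun t => t ∈ diagram β)
    {W : ℕ → Set ℕ} (hW : ComputablePred fun q : ℕ × ℕ => IsLeast (W q.1) q.2) :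
    ComputablePred fun q : ℕ × (ℕ × ℕ × ℕ) => q.2 ∈ markedDiagram α β (W q.1) := by
  have hx : Computable fun q : ℕ × (ℕ × ℕ × ℕ) => q.2.1 := Computable.fst.comp Computable.snd
  have hy : Computable fun q : ℕ × (ℕ × ℕ × ℕ) => q.2.2.1 :=
    Computable.fst.comp (Computable.snd.comp Computable.snd)
  have hz : Computable fun q : ℕ × (ℕ × ℕ × ℕ) => q.2.2.2 :=
    Computable.snd.comp (Computable.snd.comp Computable.snd)
  have left : ∀ {g : ℕ × (ℕ × ℕ × ℕ) → ℕ}, Computable g → Computable fun q => (g q).unpair.1 :=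
    fun hg => Computable.fst.comp (Computable.unpair.comp hg)
  have right : ∀ {g : ℕ × (ℕ × ℕ × ℕ) → ℕ}, Computable g → Computable fun q => (g q).unpair.2 :=
    fun hg => Computable.snd.comp (Computable.unpair.comp hg)
  have valid : ∀ {g : ℕ × (ℕ × ℕ × ℕ) → ℕ}, Computable g →
      ComputablePred fun q => ValidMarker (β 1) (W q.1) (g q).unpair.2 := fun hg =>
    (computablePred_validMarker (β 1) hW).comp (Computable.fst.pair (right hg))
  exact (hα.comp ((left hx).pair ((left hy).pair (left hz)))).and
    ((hβ.comp ((left (right hx)).pair ((left (right hy)).pair (left (right hz))))).and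
      ((valid hx).and ((valid hy).and (valid hz))))

end Marked

/-! ### Uniformly computable families of groups -/

/-- A uniformly decidable sequence of copies of groups has a computable sequence of indices, and if
the groups are infinite, the copies may be taken to have universe `ℕ`. -/
theorem exists_computable_isIndexOf {G : ℕ → Type} [∀ e, Group (G e)] {ν : ∀ e, G e → ℕ}
    (hν : ∀ e, Function.Injective (ν e))
    (hd : ComputablePred fun q : ℕ × (ℕ × ℕ × ℕ) => q.2 ∈ diagram (ν q.1))
    (h1 : Computable fun e => ν e 1) :
    ∃ f : ℕ → ℕ, Computable f ∧ ∀ e, ∃ K : NatGroup, IsIndexOf (f e) K ∧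
      ((∀ e, Infinite (G e)) → K.carrier = Set.univ) ∧ Nonempty (K.carrier ≃* G e) := by
  by_cases hinf : ∀ e, Infinite (G e)
  -- Here the `n`-th code in increasing order is renamed to `n`.
  · have hU : ComputablePred fun q : ℕ × ℕ => q.2 ∈ Set.range (ν q.1) :=
      (hd.comp (Computable.fst.pair (Computable.snd.pair
        ((h1.comp Computable.fst).pair Computable.snd)))).of_eq fun q =>
        (mem_range_iff_mem_diagram (hν q.1)).symm
    have hn : Computable fun q : ℕ × ℕ => Nat.nth (· ∈ Set.range (ν q.1)) q.2 :=
      hU.nth (U := fun e n => n ∈ Set.range (ν e)) fun e =>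
        Set.infinite_range_of_injective (hν e)
    have hd' : ComputablePred fun q : ℕ × (ℕ × ℕ × ℕ) => q.2 ∈ diagram (rankCode (ν q.1)) := by
      refine (hd.comp (Computable.fst.pair
        ((hn.comp (Computable.fst.pair (Computable.fst.comp Computable.snd))).pair
        ((hn.comp (Computable.fst.pair (Computable.fst.comp (Computable.snd.comp
          Computable.snd)))).pair
        (hn.comp (Computable.fst.pair (Computable.snd.comp (Computable.snd.comp
          Computable.snd)))))))).of_eq ?_
      rintro ⟨e, x, y, z⟩
      exact (mem_diagram_rankCode (hν e)).symm
    obtain ⟨f, hf, hfe⟩ :=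
      exists_computable_computesSet (p := fun e t => t ∈ diagram (rankCode (ν e))) hd'
    refine ⟨f, hf, fun e => ⟨.ofInjective _ (rankCode_injective (hν e)), ?_,
      fun _ => (rankCode_surjective (hν e)).range_eq, ⟨NatGroup.ofInjectiveEquiv _ _⟩⟩⟩
    rw [IsIndexOf, NatGroup.atomicDiagram_ofInjective]
    exact hfe e
  · obtain ⟨f, hf, hfe⟩ := exists_computable_computesSet (p := fun e t => t ∈ diagram (ν e)) hd
    refine ⟨f, hf, fun e => ⟨.ofInjective _ (hν e), ?_, fun h => absurd h hinf,
      ⟨NatGroup.ofInjectiveEquiv _ _⟩⟩⟩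
    rw [IsIndexOf, NatGroup.atomicDiagram_ofInjective]
    exact hfe e

/-- From a `Π⁰₁` set one computes indices of groups that are copies of `A` on the set and copies of
`A × B` off it. -/
theorem exists_computable_isIndexOf_of_piZeroOne {A B : Type} [Group A] [Group B]
    (hA : IsComputableGroup A) (hB : IsComputableGroup B) {S : Set ℕ} (hS : S ∈ PiZeroOne) :
    ∃ f : ℕ → ℕ, Computable f ∧ ∀ e, ∃ K : NatGroup, IsIndexOf (f e) K ∧
      (Infinite A → K.carrier = Set.univ) ∧
      (e ∈ S → Nonempty (K.carrier ≃* A)) ∧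
      (e ∉ S → Nonempty (K.carrier ≃* A × B)) := by
  obtain ⟨R, hR, hSR⟩ := hS
  obtain ⟨α, hα, hαd⟩ := hA.exists_injective
  obtain ⟨β, hβ, hβd⟩ := hB.exists_injective
  let W : ℕ → Set ℕ := fun e => {n | ¬ R e n}
  have hd : ComputablePred fun q : ℕ × (ℕ × ℕ × ℕ) =>
      q.2 ∈ diagram (markedCode α β (W q.1)) :=
    (computablePred_markedDiagram hαd hβd hR.isLeast_not).of_eq fun q => by
      rw [diagram_markedCode hα hβ]
  have h1 : Computable fun e => markedCode α β (W e) 1 :=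
    (Computable.const (Nat.pair (α 1) (Nat.pair (β 1) 0))).of_eq fun e => by simp [markedCode]
  obtain ⟨f, hf, hfe⟩ := exists_computable_isIndexOf
    (fun e => markedCode_injective hα hβ (W e)) hd h1
  have hW : ∀ e, e ∉ S ↔ (W e).Nonempty := fun e => by
    rw [hSR, not_forall]
    rfl
  refine ⟨f, hf, fun e => ?_⟩
  obtain ⟨K, hK, hu, ⟨i⟩⟩ := hfe e
  refine ⟨K, hK, fun h => hu fun _ => inferInstance, fun he => ?_, fun he => ?_⟩
  · obtain ⟨j⟩ := nonempty_prod_eventSubgroup_of_not (A := A) (B := B)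
      (fun h => (hW e).2 h he)
    exact ⟨i.trans j⟩
  · obtain ⟨j⟩ := nonempty_prod_eventSubgroup_of (A := A) (B := B) ((hW e).1 he)
    exact ⟨i.trans j⟩

/-- Divergence of `φ_e(e)` means that no bounded computation of it halts. -/
theorem setOf_not_phi_dom_mem_piZeroOne : {e | ¬ (phi e e).Dom} ∈ PiZeroOne := by
  refine ⟨fun e n => ¬ (Nat.Partrec.Code.evaln n (Denumerable.ofNat _ e) e).isSome, ?_, ?_⟩
  · have h : Computable fun p : ℕ × ℕ =>
        (Nat.Partrec.Code.evaln p.2 (Denumerable.ofNat _ p.1) p.1).isSome :=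
      Primrec.option_isSome.to_comp.comp (Nat.Partrec.Code.primrec_evaln.to_comp.comp
        ((Computable.snd.pair ((Computable.ofNat _).comp Computable.fst)).pair Computable.fst))
    exact (ComputablePred.computable_iff.2 ⟨_, h, rfl⟩).not
  · intro e
    simp only [Set.mem_ofPred_eq, phi, Part.dom_iff_mem, Nat.Partrec.Code.evaln_complete,
      Option.isSome_iff_exists, Option.mem_def]
    exact ⟨fun h n ⟨a, ha⟩ => h ⟨a, n, ha⟩, fun h ⟨a, n, ha⟩ => h n ⟨a, ha⟩⟩

theorem mainTheorem2 (P : GroupProperty) (hP : IsoInvariant P)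
    (Gp Gm : Type) [Group Gp] [Group Gm]
    (hM : IsMarkovWitness IsComputableGroup P Gp Gm) :
    DetectionHard PiZeroOne computableGroupIndices P ∧
    (Infinite Gp → DetectionHard PiZeroOne omegaGroupIndices P) ∧
    ∃ f : ℕ → ℕ, Computable f ∧ ∀ e, ∃ G : NatGroup, IsIndexOf (f e) G ∧
      (Infinite Gp → G.carrier = Set.univ) ∧
      (¬ (phi e e).Dom → Nonempty (G.carrier ≃* Gp)) ∧
      ((phi e e).Dom → Nonempty (G.carrier ≃* Gp × Gm)) := by
  obtain ⟨hGp, hPp, hGm, hneg⟩ := hM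
  -- The index found depends only on `S`, so hardness holds in any set of indices that contains the
  -- indices of all groups whose universe is `ℕ` whenever `Gp` is infinite.
  have hard : ∀ 𝒜 : Set ℕ, (∀ e (K : NatGroup), IsIndexOf e K →
      (Infinite Gp → K.carrier = Set.univ) → e ∈ 𝒜) → DetectionHard PiZeroOne 𝒜 P := by
    intro 𝒜 h𝒜 S hS
    obtain ⟨f, hf, hfe⟩ := exists_computable_isIndexOf_of_piZeroOne hGp hGm hS
    have hmem : ∀ e, f e ∈ 𝒜 := fun e =>
      let ⟨K, hK, hu, _⟩ := hfe e
      h𝒜 _ K hK hu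
    refine ⟨f, hf, hmem, fun e => ?_⟩
    obtain ⟨K, hK, -, hpos, hoff⟩ := hfe e
    constructor
    · intro he
      obtain ⟨i⟩ := hpos he
      exact ⟨hmem e, K, hK, hP _ _ ⟨i.symm⟩ hPp⟩
    · rintro ⟨-, K', hK', hPK⟩
      obtain rfl := hK.unique hK'
      by_contra he
      obtain ⟨i⟩ := hoff he
      exact hneg _ ⟨i.symm.toMonoidHom.comp (MonoidHom.inr Gp Gm),
        i.symm.injective.comp (Prod.mk_right_injective 1)⟩ hPK
  refine ⟨hard _ fun e K hK _ => ⟨K, hK⟩, fun hinf => hard _ fun e K hK hu => ⟨K, hK, hu hinf⟩, ?_⟩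
  obtain ⟨f, hf, hfe⟩ :=
    exists_computable_isIndexOf_of_piZeroOne hGp hGm setOf_not_phi_dom_mem_piZeroOne
  refine ⟨f, hf, fun e => ?_⟩
  obtain ⟨K, hK, hu, hpos, hoff⟩ := hfe e
  exact ⟨K, hK, hu, hpos, fun h => hoff (not_not.2 h)⟩
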